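/- **Setting.** Let $A_1,\dots,A_n\in\mathbb R^d$ and $k\ge 2$. For centers $\nu=(\nu_1,\dots,\nu_k)$ let $\mathrm{cost}(\nu)=\sum_i\min_r|A_i-\nu_r|^2$, and let $\Delta_m$ be the least cost that can be achieved with $m$ centers. Suppose that $\Delta_k\le\varepsilon\,\Delta_{k-1}$ for some $\varepsilon\ge 0$ (the condition of Ostrovsky et al.). For an optimal clustering $T_1,\dots,T_k$ (one whose cost with respect to its cluster means equals $\Delta_k$) let $n_r=|T_r|$, let $\mu_r$ be the mean of $T_r$, let $A$ be the $n\times d$ matrix with rows $A_i$, let $C$ be the $n\times d$ matrix with $C_i=\mu_r$ for $i\in T_r$, and let $\Delta_{rs}=\left(\frac{ck}{\sqrt{n_r}}+\frac{ck}{\sqrt{n_s}}\right)\|A-C\|$, with the spectral norm and a constant $c>0$. A point $A_i\in T_r$ satisfies the *proximity condition* if for every $s\ne r$ its orthogonal projection onto the line through $\mu_r$ and $\mu_s$ is at least $\Delta_{rs}$ closer to $\mu_r$ than to $\mu_s$. The algorithm **Cluster** starts with centers $\nu^{(0)}$ that are a $\beta$-approximate solution ($\beta\ge1$) of the $k$-means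 problem for the projections of the points onto a best $k$-dimensional subspace (found by SVD), and then performs Lloyd iterations: each point is assigned to a closest center (ties broken arbitrarily), and each center is replaced by the mean of the points assigned to it (a center with no points is kept). Let $\nu^{(t)}$ be the centers after $t$ iterations. **Theorem.** 1. There is a constant $K=K(k,c)$ such that, for every optimal clustering, at most $(1+K\sqrt\varepsilon)\,\varepsilon n$ of the $n$ points do not satisfy the proximity condition. 2. There is a constant $K=K(k,\beta)$ such that every run of Cluster satisfies, for all $t\ge1$, $$\mathrm{cost}(\nu^{(t)})\le(1+K\sqrt\varepsilon)\,\Delta_k .$$ 3. (Without the condition $\Delta_k\le\varepsilon\Delta_{k-1}$.) With any routine for computing $\nu^{(0)}$, Cluster with $t$ iterations is carried out by an explicit program whose number of arithmetic operations and comparisons on real numbers is at most that of the routine plus $O\big(t\,(n+1)\,k\,(d+1)\big)$, with an absolute constant. Thus, given a polynomial-time $\beta$-approximate routine for the starting centers (with $\beta$ a constant), Cluster with any positive polynomial number of iterations runs in polynomial time and, for every $\delta>0$, has approximation ratio at most $1+\delta$ on the instances with $\Delta_k\le\varepsilon\Delta_{k-1}$, $\varepsilon\le(\delta/K)^2$.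 In this sense Cluster is a PTAS for the $k$-means problem under the condition. -/

import Mathlib

open scoped BigOperators

noncomputable section

/-! ## The `k`-means problem -/

/-- The `k`-means cost of the centers `ν` on the points `A 0, …, A (n-1)`: the sum of the squared
distances of the points to their nearest centers. -/
def kmeansCost {n d k : ℕ} (A : Fin n → EuclideanSpace ℝ (Fin d))
    (ν : Fin k → EuclideanSpace ℝ (Fin d)) : ℝ :=
  ∑ i, ⨅ r, dist (A i) (ν r) ^ 2

/-- The optimal `k`-means cost with `k` centers. -/
def optCost {n d : ℕ} (k : ℕ) (A : Fin n → EuclideanSpace ℝ (Fin d)) : ℝ :=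
  ⨅ ν : Fin k → EuclideanSpace ℝ (Fin d), kmeansCost A ν

/-- The indices of the points in the cluster with label `r`. -/
def cluster {n k : ℕ} (T : Fin n → Fin k) (r : Fin k) : Finset (Fin n) :=
  Finset.univ.filter (fun i => T i = r)

/-- The mean of the cluster with label `r`. -/
def clusterMean {n d k : ℕ} (A : Fin n → EuclideanSpace ℝ (Fin d)) (T : Fin n → Fin k)
    (r : Fin k) : EuclideanSpace ℝ (Fin d) :=
  ((cluster T r).card : ℝ)⁻¹ • ∑ i ∈ cluster T r, A i

/-- `T` is an optimal clustering: together with its cluster means it attains the optimal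
`k`-means cost. -/
def IsOptimalClustering {n d k : ℕ} (A : Fin n → EuclideanSpace ℝ (Fin d))
    (T : Fin n → Fin k) : Prop :=
  ∑ i, dist (A i) (clusterMean A T (T i)) ^ 2 = optCost k A

/-! ## The proximity condition -/

/-- The `n × d` matrix `A - C`, whose `i`-th row is `A i` minus the mean of its cluster. -/
def deviationMatrix {n d k : ℕ} (A : Fin n → EuclideanSpace ℝ (Fin d)) (T : Fin n → Fin k) :
    Matrix (Fin n) (Fin d) ℝ :=
  Matrix.of fun i j => A i j - clusterMean A T (T i) j

open scoped Matrix.Norms.L2Operator in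
/-- The spectral norm `‖A - C‖`. -/
def spectralDeviation {n d k : ℕ} (A : Fin n → EuclideanSpace ℝ (Fin d)) (T : Fin n → Fin k) :
    ℝ :=
  ‖deviationMatrix A T‖

/-- `Δ_{rs} = (c k / √n_r + c k / √n_s) ‖A - C‖`. -/
def proximityGap {n d k : ℕ} (c : ℝ) (A : Fin n → EuclideanSpace ℝ (Fin d)) (T : Fin n → Fin k)
    (r s : Fin k) : ℝ :=
  (c * k / √((cluster T r).card : ℝ) + c * k / √((cluster T s).card : ℝ)) * spectralDeviation A T

/-- The orthogonal projection of `x` onto the line through `p` and `q`. -/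
def projLine {d : ℕ} (p q x : EuclideanSpace ℝ (Fin d)) : EuclideanSpace ℝ (Fin d) :=
  EuclideanGeometry.orthogonalProjection (affineSpan ℝ {p, q}) x

/-- The point `A i`, in the cluster `r = T i`, satisfies the proximity condition: for every `s ≠ r`
its projection onto the line through the means `μ_r` and `μ_s` is at least `Δ_{rs}` closer to `μ_r`
than to `μ_s`. -/
def SatisfiesProximity {n d k : ℕ} (c : ℝ) (A : Fin n → EuclideanSpace ℝ (Fin d))
    (T : Fin n → Fin k) (i : Fin n) : Prop :=
  ∀ s : Fin k, s ≠ T i →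
    dist (projLine (clusterMean A T (T i)) (clusterMean A T s) (A i)) (clusterMean A T (T i))
        + proximityGap c A T (T i) s ≤
      dist (projLine (clusterMean A T (T i)) (clusterMean A T s) (A i)) (clusterMean A T s)

/-! ## The algorithm `Cluster`, as a process -/

/-- The projections of the points onto the linear subspace `V`. -/
def projPoints {n d : ℕ} (V : Submodule ℝ (EuclideanSpace ℝ (Fin d)))
    (A : Fin n → EuclideanSpace ℝ (Fin d)) : Fin n → EuclideanSpace ℝ (Fin d) :=
  fun i => V.starProjection (A i)

/-- `V` is a best subspace of dimension at most `k` for the points: it minimizes the sum of the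
squared distances to the points, as the span of the top `k` right singular vectors does. -/
def IsBestSubspace {n d : ℕ} (k : ℕ) (A : Fin n → EuclideanSpace ℝ (Fin d))
    (V : Submodule ℝ (EuclideanSpace ℝ (Fin d))) : Prop :=
  Module.finrank ℝ V ≤ k ∧
    ∀ W : Submodule ℝ (EuclideanSpace ℝ (Fin d)), Module.finrank ℝ W ≤ k →
      ∑ i, dist (A i) (projPoints V A i) ^ 2 ≤ ∑ i, dist (A i) (projPoints W A i) ^ 2

/-- The base case: `ν` is a `β`-approximate solution of the `k`-means problem for the projections
of the points onto a best `k`-dimensional subspace. -/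
def IsBaseCenters {n d k : ℕ} (β : ℝ) (A : Fin n → EuclideanSpace ℝ (Fin d))
    (ν : Fin k → EuclideanSpace ℝ (Fin d)) : Prop :=
  ∃ V : Submodule ℝ (EuclideanSpace ℝ (Fin d)), IsBestSubspace k A V ∧
    kmeansCost (projPoints V A) ν ≤ β * optCost k (projPoints V A)

/-- One iteration of `k`-means (Lloyd): every point is assigned to a closest center of `ν` (ties
broken in any way), and every center is replaced by the mean of the points assigned to it; a center
without points is kept. -/
def IsLloydStep {n d k : ℕ} (A : Fin n → EuclideanSpace ℝ (Fin d))
    (ν η : Fin k → EuclideanSpace ℝ (Fin d)) : Prop :=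
  ∃ S : Fin n → Fin k, (∀ i r, dist (A i) (ν (S i)) ≤ dist (A i) (ν r)) ∧
    ∀ r, ((cluster S r).Nonempty → η r = clusterMean A S r) ∧ (cluster S r = ∅ → η r = ν r)

/-- `ν 0, ν 1, …` are the successive centers of a run of `Cluster`, where the base case uses a
`β`-approximate solution. -/
def IsClusterRun {n d k : ℕ} (β : ℝ) (A : Fin n → EuclideanSpace ℝ (Fin d))
    (ν : ℕ → Fin k → EuclideanSpace ℝ (Fin d)) : Prop :=
  IsBaseCenters β A (ν 0) ∧ ∀ t, IsLloydStep A (ν t) (ν (t + 1))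

/-! ## The algorithm `Cluster`, as a program with a step count -/

/-- The arithmetic operations on real numbers. -/
inductive ArithOp where
  | add
  | sub
  | mul
  | div

/-- The value of an arithmetic operation. -/
def ArithOp.eval : ArithOp → ℝ → ℝ → ℝ
  | .add, x, y => x + y
  | .sub, x, y => x - y
  | .mul, x, y => x * y
  | .div, x, y => x / y

/-- Programs over the real numbers with result in `α`: a program returns a result, or performs one
arithmetic operation on two reals, or one comparison `x ≤ y`, and continues with its outcome. -/
inductive RealProg (α : Type) : Type where
  | ret (a : α) : RealProg α
  | arith (o : ArithOp) (x y : ℝ) (next : ℝ → RealProg α) : RealProg α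
  | test (x y : ℝ) (next : Bool → RealProg α) : RealProg α

namespace RealProg

/-- Run a program, and continue with another one on its result. -/
def seq {α γ : Type} : RealProg α → (α → RealProg γ) → RealProg γ
  | ret a, f => f a
  | arith o x y next, f => arith o x y fun z => seq (next z) f
  | test x y next, f => test x y fun b => seq (next b) f

instance : Monad RealProg where
  pure := ret
  bind := seq

open Classical in
/-- The result of a program. -/
def run {α : Type} : RealProg α → α
  | ret a => a
  | arith o x y next => run (next (o.eval x y))
  | test x y next => run (next (decide (x ≤ y)))

open Classical in
/-- The number of arithmetic operations and comparisons that a program performs. -/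
def steps {α : Type} : RealProg α → ℕ
  | ret _ => 0
  | arith o x y next => steps (next (o.eval x y)) + 1
  | test x y next => steps (next (decide (x ≤ y))) + 1

/-- The program for one arithmetic operation. -/
def op (o : ArithOp) (x y : ℝ) : RealProg ℝ := arith o x y ret

/-- The program for one comparison: is `x ≤ y`? -/
def le (x y : ℝ) : RealProg Bool := test x y ret

/-- Squared distance of two points. -/
def sqDist {d : ℕ} (x y : Fin d → ℝ) : RealProg ℝ :=
  (List.finRange d).foldlM (fun s j => do
    let t ← op .sub (x j) (y j)
    let q ← op .mul t t
    op .add s q) 0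

/-- Sum of two vectors. -/
def addVec {d : ℕ} (x y : Fin d → ℝ) : RealProg (Fin d → ℝ) :=
  (List.finRange d).foldlM (fun v j => do
    let s ← op .add (x j) (y j)
    pure (Function.update v j s)) x

/-- A vector divided by a real number. -/
def divVec {d : ℕ} (x : Fin d → ℝ) (m : ℝ) : RealProg (Fin d → ℝ) :=
  (List.finRange d).foldlM (fun v j => do
    let s ← op .div (x j) m
    pure (Function.update v j s)) x

/-- The index of a center closest to `x`. -/
def nearest {d k : ℕ} [NeZero k] (x : Fin d → ℝ) (ν : Fin k → Fin d → ℝ) : RealProg (Fin k) := do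
  let start ← sqDist x (ν 0)
  let best ← (List.finRange k).foldlM (fun (b : Fin k × ℝ) r => do
    let t ← sqDist x (ν r)
    let keep ← le b.2 t
    pure (if keep then b else (r, t))) ((0 : Fin k), start)
  pure best.1

/-- The sizes and the vector sums of the clusters that arise when every point is assigned to a
closest center. -/
def clusterSums {n d k : ℕ} [NeZero k] (A : Fin n → Fin d → ℝ) (ν : Fin k → Fin d → ℝ) :
    RealProg ((Fin k → ℝ) × (Fin k → Fin d → ℝ)) :=
  (List.finRange n).foldlM (fun (st : (Fin k → ℝ) × (Fin k → Fin d → ℝ)) i => do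
    let r ← nearest (A i) ν
    let m ← op .add (st.1 r) 1
    let v ← addVec (st.2 r) (A i)
    pure (Function.update st.1 r m, Function.update st.2 r v)) (0, 0)

/-- One iteration of `k`-means (Lloyd). -/
def lloydStep {n d k : ℕ} [NeZero k] (A : Fin n → Fin d → ℝ) (ν : Fin k → Fin d → ℝ) :
    RealProg (Fin k → Fin d → ℝ) := do
  let st ← clusterSums A ν
  (List.finRange k).foldlM (fun η r => do
    let isEmpty ← le (st.1 r) 0
    if isEmpty then pure η
    else do
      let v ← divVec (st.2 r) (st.1 r)
      pure (Function.update η r v)) ν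

/-- `t` iterations of `k`-means (Lloyd). -/
def lloydIter {n d k : ℕ} [NeZero k] (A : Fin n → Fin d → ℝ) :
    ℕ → (Fin k → Fin d → ℝ) → RealProg (Fin k → Fin d → ℝ)
  | 0, ν => pure ν
  | t + 1, ν => do
    let η ← lloydStep A ν
    lloydIter A t η

/-- The algorithm `Cluster`: the base routine computes the initial centers from the points, and
`t` iterations of `k`-means follow. -/
def clusterProg {n d k : ℕ} [NeZero k]
    (base : (Fin n → EuclideanSpace ℝ (Fin d)) → RealProg (Fin k → EuclideanSpace ℝ (Fin d)))
    (t : ℕ) (A : Fin n → EuclideanSpace ℝ (Fin d)) :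
    RealProg (Fin k → EuclideanSpace ℝ (Fin d)) := do
  let ν ← base A
  let η ← lloydIter (fun i j => A i j) t (fun r j => ν r j)
  pure (fun r => WithLp.toLp 2 (η r))

end RealProg

end

/-!
Everything rests on one separation estimate. Merging two clusters `r`, `s` of an optimal clustering
and centering them at their joint mean costs `n_r n_s / (n_r + n_s) |μ_r - μ_s|²` by the parallel
axis theorem, so `Δ_{k-1} ≤ Δ_k + n_r n_s / (n_r + n_s) |μ_r - μ_s|²` (`optCost_pred_le_merge`). Under
`Δ_k ≤ ε Δ_{k-1}` the means are therefore far apart: `|μ_r - μ_s|²` is at least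
`(1/ε - 1) (1/n_r + 1/n_s) Δ_k` (`optCost_le_dist_clusterMean`).

*Proximity.* The spectral norm of `A - C` is at most its Frobenius norm `√Δ_k`, so the gap `Δ_{rs}`
is at most an `O(√ε)` fraction of `|μ_r - μ_s|` (`proximityGap_le`). A point that violates the
condition has distance at least `(1 - O(√ε)) |μ_r - μ_s| / 2` from its own mean, and since
`n_r n_s / (n_r + n_s) ≤ n / 4`, it contributes at least `(1 - O(√ε)) Δ_k / (ε n)` to the cost `Δ_k`
(`optCost_le_of_not_satisfiesProximity`). Hence there are at most `(1 + O(√ε)) ε n` such points.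

*Approximation.* The initial centers have cost at most `(2 + 2 β) Δ_k`
(`IsBaseCenters.kmeansCost_le`), so each mean `μ_r` has a center at squared distance `O(Δ_k / n_r)`,
that is, within an `O(√ε)` fraction of the distances to the other means. This matches the centers
with the means. A point that the first Lloyd step assigns to a mean other than its own has nearly
equal distances to the two means, so assigning it to the other one costs a factor `1 + O(√ε)` only
(`kmeansCost_lloydStep_le_of_near`); replacing the matched means by the means of the new clusters
can only help, and later Lloyd steps do not increase the cost. When `ε` is not small, the bound
`(2 + 2 β) Δ_k` already suffices.

*Program.* Results and step counts of programs are compositional, so they follow the structure of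
the program: `RealProg.isLloydStep_run_lloydStep` identifies the result of an iteration and
`RealProg.steps_lloydStep_le` counts its steps.
-/

/-! ### Costs, cluster means and merged clusters -/

section Costs

variable {n d k : ℕ} {A : Fin n → EuclideanSpace ℝ (Fin d)}

theorem kmeansCost_nonneg (A : Fin n → EuclideanSpace ℝ (Fin d))
    (ν : Fin k → EuclideanSpace ℝ (Fin d)) : 0 ≤ kmeansCost A ν :=
  Finset.sum_nonneg fun _ _ => Real.iInf_nonneg fun _ => sq_nonneg _

theorem optCost_nonneg (k : ℕ) (A : Fin n → EuclideanSpace ℝ (Fin d)) : 0 ≤ optCost k A :=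
  Real.iInf_nonneg fun ν => kmeansCost_nonneg A ν

theorem kmeansCost_le_sum (A : Fin n → EuclideanSpace ℝ (Fin d))
    (ν : Fin k → EuclideanSpace ℝ (Fin d)) (S : Fin n → Fin k) :
    kmeansCost A ν ≤ ∑ i, dist (A i) (ν (S i)) ^ 2 :=
  Finset.sum_le_sum fun i _ => ciInf_le (Set.finite_range _).bddBelow (S i)

theorem kmeansCost_eq_sum {ν : Fin k → EuclideanSpace ℝ (Fin d)} {S : Fin n → Fin k}
    (hS : ∀ i r, dist (A i) (ν (S i)) ≤ dist (A i) (ν r)) :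
    kmeansCost A ν = ∑ i, dist (A i) (ν (S i)) ^ 2 := by
  refine le_antisymm (kmeansCost_le_sum A ν S) (Finset.sum_le_sum fun i _ => ?_)
  have : Nonempty (Fin k) := ⟨S i⟩
  exact le_ciInf fun r => pow_le_pow_left₀ dist_nonneg (hS i r) 2

theorem exists_nearest_assignment [NeZero k] (A : Fin n → EuclideanSpace ℝ (Fin d))
    (ν : Fin k → EuclideanSpace ℝ (Fin d)) :
    ∃ S : Fin n → Fin k, ∀ i r, dist (A i) (ν (S i)) ≤ dist (A i) (ν r) := by
  choose S hS using fun i => Finite.exists_min fun r => dist (A i) (ν r)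
  exact ⟨S, hS⟩

theorem optCost_le_kmeansCost (A : Fin n → EuclideanSpace ℝ (Fin d))
    (ν : Fin k → EuclideanSpace ℝ (Fin d)) : optCost k A ≤ kmeansCost A ν :=
  ciInf_le ⟨0, by rintro _ ⟨ν, rfl⟩; exact kmeansCost_nonneg A ν⟩ ν

theorem sum_eq_sum_cluster (T : Fin n → Fin k) (f : Fin n → ℝ) :
    ∑ i, f i = ∑ r, ∑ i ∈ cluster T r, f i :=
  (Finset.sum_fiberwise _ T f).symm

/-- The parallel axis theorem. For an empty cluster both sides vanish, whatever its mean is set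
to. -/
theorem sum_cluster_dist_sq (A : Fin n → EuclideanSpace ℝ (Fin d)) (T : Fin n → Fin k)
    (r : Fin k) (w : EuclideanSpace ℝ (Fin d)) :
    ∑ i ∈ cluster T r, dist (A i) w ^ 2 =
      ∑ i ∈ cluster T r, dist (A i) (clusterMean A T r) ^ 2 +
        (cluster T r).card * dist (clusterMean A T r) w ^ 2 := by
  rcases (cluster T r).eq_empty_or_nonempty with h | h
  · simp [h]
  set m := clusterMean A T r with hm
  have hc : ((cluster T r).card : ℝ) ≠ 0 := by exact_mod_cast h.card_ne_zero
  have hsum : ∑ i ∈ cluster T r, (A i - m) = 0 := by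
    rw [Finset.sum_sub_distrib, Finset.sum_const, hm, clusterMean, ← Nat.cast_smul_eq_nsmul ℝ,
      smul_smul, mul_inv_cancel₀ hc, one_smul, sub_self]
  have hx : ∀ i, dist (A i) w ^ 2 =
      dist (A i) m ^ 2 + 2 * inner ℝ (A i - m) (m - w) + dist m w ^ 2 := fun i => by
    rw [dist_eq_norm, dist_eq_norm, dist_eq_norm, ← norm_add_sq_real, sub_add_sub_cancel]
  simp_rw [hx]
  rw [Finset.sum_add_distrib, Finset.sum_add_distrib, ← Finset.mul_sum, ← sum_inner, hsum]
  simp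

/-- The cost of a clustering with arbitrary centers exceeds that with the cluster means by the
weighted squared distances of the centers to the means. -/
theorem sum_dist_sq_eq (A : Fin n → EuclideanSpace ℝ (Fin d)) (T : Fin n → Fin k)
    (w : Fin k → EuclideanSpace ℝ (Fin d)) :
    ∑ i, dist (A i) (w (T i)) ^ 2 =
      ∑ i, dist (A i) (clusterMean A T (T i)) ^ 2 +
        ∑ r, (cluster T r).card * dist (clusterMean A T r) (w r) ^ 2 := by
  have key : ∀ v : Fin k → EuclideanSpace ℝ (Fin d), ∑ i, dist (A i) (v (T i)) ^ 2 =
      ∑ r, ∑ i ∈ cluster T r, dist (A i) (v r) ^ 2 := fun v => by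
    rw [sum_eq_sum_cluster T]
    refine Finset.sum_congr rfl fun r _ => Finset.sum_congr rfl fun i hi => ?_
    rw [(Finset.mem_filter.mp hi).2]
  rw [key w, key (clusterMean A T), ← Finset.sum_add_distrib]
  exact Finset.sum_congr rfl fun r _ => sum_cluster_dist_sq A T r (w r)

theorem sum_clusterMean_le (A : Fin n → EuclideanSpace ℝ (Fin d)) (T : Fin n → Fin k)
    (w : Fin k → EuclideanSpace ℝ (Fin d)) :
    ∑ i, dist (A i) (clusterMean A T (T i)) ^ 2 ≤ ∑ i, dist (A i) (w (T i)) ^ 2 := by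
  rw [sum_dist_sq_eq A T w]
  exact le_add_of_nonneg_right (by positivity)

theorem exists_isOptimalClustering [NeZero k] (A : Fin n → EuclideanSpace ℝ (Fin d)) :
    ∃ T : Fin n → Fin k, IsOptimalClustering A T := by
  obtain ⟨T, hT⟩ := Finite.exists_min fun T : Fin n → Fin k =>
    ∑ i, dist (A i) (clusterMean A T (T i)) ^ 2
  refine ⟨T, le_antisymm (le_ciInf fun ν => ?_)
    ((optCost_le_kmeansCost A _).trans (kmeansCost_le_sum A (clusterMean A T) T))⟩
  obtain ⟨S, hS⟩ := exists_nearest_assignment A ν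
  rw [kmeansCost_eq_sum hS]
  exact (hT S).trans (sum_clusterMean_le A S ν)

theorem optCost_pred_le_of_eq {T : Fin n → Fin k} {w : Fin k → EuclideanSpace ℝ (Fin d)}
    {r s : Fin k} (hrs : r ≠ s) (hw : w r = w s) :
    optCost (k - 1) A ≤ ∑ i, dist (A i) (w (T i)) ^ 2 := by
  obtain ⟨m, rfl⟩ : ∃ m, k = m + 1 := ⟨k - 1, by have := r.2; omega⟩
  have hj : ∀ q : Fin (m + 1), ∃ j : Fin m, w (s.succAbove j) = w q := fun q => by
    rcases eq_or_ne q s with rfl | hq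
    · obtain ⟨j, hj⟩ := Fin.exists_succAbove_eq hrs
      exact ⟨j, by rw [hj, hw]⟩
    · obtain ⟨j, hj⟩ := Fin.exists_succAbove_eq hq
      exact ⟨j, by rw [hj]⟩
  choose j hj using hj
  refine (optCost_le_kmeansCost A (w ∘ s.succAbove)).trans
    ((kmeansCost_le_sum A _ (j ∘ T)).trans_eq ?_)
  simp [hj]

/-- Merging two clusters of an optimal clustering into one, centered at their joint mean, yields a
solution with one center less. -/
theorem optCost_pred_le_merge {T : Fin n → Fin k} (hT : IsOptimalClustering A T)
    {r s : Fin k} (hrs : r ≠ s) :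
    optCost (k - 1) A ≤ optCost k A +
      ((cluster T r).card * (cluster T s).card / ((cluster T r).card + (cluster T s).card) : ℝ) *
        dist (clusterMean A T r) (clusterMean A T s) ^ 2 := by
  set a : ℝ := ((cluster T r).card : ℝ) with ha
  set b : ℝ := ((cluster T s).card : ℝ) with hb
  set μ := clusterMean A T with hμ
  have ha0 : 0 ≤ a := Nat.cast_nonneg _
  have hb0 : 0 ≤ b := Nat.cast_nonneg _
  set p := AffineMap.lineMap (k := ℝ) (μ r) (μ s) (b / (a + b)) with hp
  set w : Fin k → EuclideanSpace ℝ (Fin d) :=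
    Function.update (Function.update μ r p) s p with hw
  have hwr : w r = p := by simp [hw, hrs]
  have hws : w s = p := by simp [hw]
  refine (optCost_pred_le_of_eq (T := T) hrs (hwr.trans hws.symm)).trans_eq ?_
  rw [sum_dist_sq_eq A T w, hT]
  congr 1
  rw [Finset.sum_eq_add r s hrs (fun q _ hq => by simp [hw, hq.1, hq.2, hμ])
    (fun h => (h (Finset.mem_univ _)).elim) (fun h => (h (Finset.mem_univ _)).elim), hwr, hws,
    ← hμ, ← ha, ← hb, hp, dist_left_lineMap, dist_right_lineMap]
  simp only [Real.norm_eq_abs, mul_pow, sq_abs]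
  rcases eq_or_ne (a + b) 0 with h | h
  · have h1 : a = 0 := by linarith
    have h2 : b = 0 := by linarith
    simp [h1, h2]
  · field_simp
    ring

/-- The condition `Δ_k ≤ ε Δ_{k-1}` separates the means of any two clusters of an optimal
clustering: `|μ_r - μ_s|²` is at least `(1/ε - 1) (1/n_r + 1/n_s) Δ_k`. -/
theorem optCost_le_dist_clusterMean {T : Fin n → Fin k} (hT : IsOptimalClustering A T) {ε : ℝ}
    (hε : 0 ≤ ε) (h : optCost k A ≤ ε * optCost (k - 1) A) {r s : Fin k} (hrs : r ≠ s) :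
    (1 - ε) * optCost k A ≤ ε *
      (((cluster T r).card * (cluster T s).card / ((cluster T r).card + (cluster T s).card) : ℝ) *
        dist (clusterMean A T r) (clusterMean A T s) ^ 2) := by
  have := mul_le_mul_of_nonneg_left (optCost_pred_le_merge hT hrs) hε
  linarith

theorem dist_sq_le_optCost {T : Fin n → Fin k} (hT : IsOptimalClustering A T) (i : Fin n) :
    dist (A i) (clusterMean A T (T i)) ^ 2 ≤ optCost k A := by
  rw [← hT]
  exact Finset.single_le_sum (f := fun i => dist (A i) (clusterMean A T (T i)) ^ 2)
    (fun _ _ => sq_nonneg _) (Finset.mem_univ i)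

theorem cluster_card_pos_of_separated {T : Fin n → Fin k} (hT : IsOptimalClustering A T) {ε : ℝ}
    (hε : 0 ≤ ε) (hε1 : ε < 1) (h : optCost k A ≤ ε * optCost (k - 1) A) (hpos : 0 < optCost k A)
    {r s : Fin k} (hrs : r ≠ s) : 0 < ((cluster T r).card : ℝ) := by
  refine (Nat.cast_nonneg _).lt_of_ne fun h0 => ?_
  have := optCost_le_dist_clusterMean hT hε h hrs
  rw [← h0] at this
  simp only [zero_mul, zero_div, mul_zero] at this
  nlinarith

end Costs

/-! ### The proximity condition under separation -/

section Proximity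

variable {n d k : ℕ} {A : Fin n → EuclideanSpace ℝ (Fin d)} {T : Fin n → Fin k}

theorem spectralDeviation_nonneg (A : Fin n → EuclideanSpace ℝ (Fin d)) (T : Fin n → Fin k) :
    0 ≤ spectralDeviation A T := by
  unfold spectralDeviation
  rw [Matrix.l2_opNorm_def]
  exact norm_nonneg _

/-- The spectral norm of `A - C` is at most its Frobenius norm, whose square is the cost of the
clustering. -/
theorem spectralDeviation_sq_le (A : Fin n → EuclideanSpace ℝ (Fin d)) (T : Fin n → Fin k) :
    spectralDeviation A T ^ 2 ≤ ∑ i, dist (A i) (clusterMean A T (T i)) ^ 2 := by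
  set F := ∑ i, dist (A i) (clusterMean A T (T i)) ^ 2 with hF
  have hF0 : 0 ≤ F := Finset.sum_nonneg fun _ _ => sq_nonneg _
  refine (Real.le_sqrt (spectralDeviation_nonneg A T) hF0).mp ?_
  unfold spectralDeviation
  rw [Matrix.l2_opNorm_def]
  refine ContinuousLinearMap.opNorm_le_bound _ (Real.sqrt_nonneg _) fun x => ?_
  refine le_of_sq_le_sq ?_ (by positivity)
  rw [mul_pow, Real.sq_sqrt hF0, EuclideanSpace.norm_sq_eq, hF, Finset.sum_mul]
  refine Finset.sum_le_sum fun i _ => ?_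
  have hrow : ((Matrix.toEuclideanLin.trans LinearMap.toContinuousLinearMap)
      (deviationMatrix A T) x) i = inner ℝ (A i - clusterMean A T (T i)) x := by
    simp [deviationMatrix, Matrix.mulVec, dotProduct, PiLp.inner_apply, mul_comm]
  rw [hrow, dist_eq_norm, ← mul_pow]
  exact pow_le_pow_left₀ (norm_nonneg _) (norm_inner_le_norm _ _) 2

theorem dist_projLine_left_le (p q x : EuclideanSpace ℝ (Fin d)) :
    dist (projLine p q x) p ≤ dist x p := by
  have h := EuclideanGeometry.dist_sq_eq_dist_orthogonalProjection_sq_add_dist_orthogonalProjection_sq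
    (s := affineSpan ℝ {p, q}) x (left_mem_affineSpan_pair ℝ p q)
  refine le_of_sq_le_sq ?_ dist_nonneg
  rw [dist_comm x p, dist_comm (projLine p q x) p]
  unfold projLine
  nlinarith [mul_self_nonneg (dist x (EuclideanGeometry.orthogonalProjection (affineSpan ℝ {p, q}) x
    : EuclideanSpace ℝ (Fin d)))]

theorem projLine_left (p q : EuclideanSpace ℝ (Fin d)) : projLine p q p = p := by
  have h := dist_projLine_left_le p q p
  rw [dist_self] at h
  exact dist_le_zero.mp h

/-- When the optimal cost is zero, every point is the mean of its cluster and all gaps vanish. -/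
theorem satisfiesProximity_of_optCost_eq_zero (c : ℝ) (hT : IsOptimalClustering A T)
    (h0 : optCost k A = 0) (i : Fin n) : SatisfiesProximity c A T i := by
  intro s _
  have hdev : spectralDeviation A T = 0 := by
    have := spectralDeviation_sq_le A T
    rw [hT, h0] at this
    exact pow_eq_zero_iff two_ne_zero |>.mp (le_antisymm this (sq_nonneg _))
  have hi : A i = clusterMean A T (T i) := by
    have := dist_sq_le_optCost hT i
    rw [h0] at this
    exact dist_eq_zero.mp (pow_eq_zero_iff two_ne_zero |>.mp (le_antisymm this (sq_nonneg _)))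
  rw [proximityGap, hdev, mul_zero, add_zero]
  nth_rewrite 2 [hi]
  rw [projLine_left, dist_comm, hi, dist_comm, projLine_left, dist_self]
  exact dist_nonneg

/-- Under the separation condition the gaps are only an `O(√ε)` fraction of the distances between
the cluster means. -/
theorem proximityGap_le {c ε : ℝ} (hc : 0 < c) (hT : IsOptimalClustering A T) (hε : 0 ≤ ε)
    (hε2 : ε ≤ 1 / 2) (h : optCost k A ≤ ε * optCost (k - 1) A) (hpos : 0 < optCost k A)
    {r s : Fin k} (hrs : r ≠ s) :
    proximityGap c A T r s ≤
      2 * c * k * √ε * dist (clusterMean A T r) (clusterMean A T s) := by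
  have hsep := optCost_le_dist_clusterMean hT hε h hrs
  have ha := cluster_card_pos_of_separated hT hε (by linarith) h hpos hrs
  have hb := cluster_card_pos_of_separated hT hε (by linarith) h hpos hrs.symm
  have hσ := spectralDeviation_sq_le A T
  rw [hT] at hσ
  have hσ0 := spectralDeviation_nonneg A T
  unfold proximityGap
  set a : ℝ := ((cluster T r).card : ℝ)
  set b : ℝ := ((cluster T s).card : ℝ)
  set D := dist (clusterMean A T r) (clusterMean A T s)
  set σ := spectralDeviation A T
  set Δ := optCost k A
  have hD0 : 0 ≤ D := dist_nonneg
  refine le_of_sq_le_sq ?_ (by positivity)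
  have hfac : c * k / √a + c * k / √b = c * k * ((√a)⁻¹ + (√b)⁻¹) := by ring
  have hsum : ((√a)⁻¹ + (√b)⁻¹) ^ 2 ≤ 2 * (a⁻¹ + b⁻¹) := by
    have h1 : (√a)⁻¹ ^ 2 = a⁻¹ := by rw [inv_pow, Real.sq_sqrt ha.le]
    have h2 : (√b)⁻¹ ^ 2 = b⁻¹ := by rw [inv_pow, Real.sq_sqrt hb.le]
    nlinarith [sq_nonneg ((√a)⁻¹ - (√b)⁻¹)]
  have hΔ : (a⁻¹ + b⁻¹) * Δ ≤ 2 * ε * D ^ 2 := by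
    have h1 : Δ ≤ 2 * ε * (a * b / (a + b) * D ^ 2) := by nlinarith
    have h2 : (a⁻¹ + b⁻¹) * (2 * ε * (a * b / (a + b) * D ^ 2)) = 2 * ε * D ^ 2 := by
      field_simp
      ring
    rw [← h2]
    exact mul_le_mul_of_nonneg_left h1 (by positivity)
  calc ((c * k / √a + c * k / √b) * σ) ^ 2
      = (c * k) ^ 2 * (((√a)⁻¹ + (√b)⁻¹) ^ 2 * σ ^ 2) := by rw [hfac]; ring
    _ ≤ (c * k) ^ 2 * (2 * (a⁻¹ + b⁻¹) * Δ) := by gcongr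
    _ ≤ (c * k) ^ 2 * (4 * ε * D ^ 2) := by
        refine mul_le_mul_of_nonneg_left ?_ (sq_nonneg _)
        linarith
    _ = (2 * c * k * √ε * D) ^ 2 := by
        nth_rewrite 1 [← Real.sq_sqrt hε]
        ring

/-- A point that violates the proximity condition lies almost halfway to another mean, so it
carries almost a `1 / (ε n)` share of the optimal cost. The constant is right because
`n_r n_s / (n_r + n_s) ≤ n / 4`. -/
theorem optCost_le_of_not_satisfiesProximity {c ε : ℝ} (hc : 0 < c)
    (hT : IsOptimalClustering A T) (hε : 0 ≤ ε) (hε2 : ε ≤ 1 / 2)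
    (h : optCost k A ≤ ε * optCost (k - 1) A) (hpos : 0 < optCost k A)
    (hgap : 2 * c * k * √ε ≤ 1) {i : Fin n} (hi : ¬ SatisfiesProximity c A T i) :
    (1 - 2 * c * k * √ε) ^ 2 * (1 - ε) * optCost k A ≤
      ε * n * dist (A i) (clusterMean A T (T i)) ^ 2 := by
  unfold SatisfiesProximity at hi
  push Not at hi
  obtain ⟨s, hs, hlt⟩ := hi
  have hg := proximityGap_le hc hT hε hε2 h hpos hs.symm
  have hsep := optCost_le_dist_clusterMean hT hε h hs.symm
  have ha := cluster_card_pos_of_separated hT hε (by linarith) h hpos hs.symm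
  have hb := cluster_card_pos_of_separated hT hε (by linarith) h hpos hs
  have hcard : ((cluster T (T i)).card : ℝ) + (cluster T s).card ≤ n := by
    have hdis : Disjoint (cluster T (T i)) (cluster T s) :=
      Finset.disjoint_filter.mpr fun j _ h1 h2 => hs (h2.symm.trans h1)
    have := Finset.card_le_univ (cluster T (T i) ∪ cluster T s)
    rw [Finset.card_union_of_disjoint hdis, Fintype.card_fin] at this
    exact_mod_cast this
  have hp := dist_projLine_left_le (clusterMean A T (T i)) (clusterMean A T s) (A i)
  have htri := dist_triangle_left (clusterMean A T (T i)) (clusterMean A T s)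
    (projLine (clusterMean A T (T i)) (clusterMean A T s) (A i))
  set a : ℝ := ((cluster T (T i)).card : ℝ)
  set b : ℝ := ((cluster T s).card : ℝ)
  set D := dist (clusterMean A T (T i)) (clusterMean A T s)
  set x := dist (A i) (clusterMean A T (T i))
  set q := 2 * c * k * √ε
  have hD0 : 0 ≤ D := dist_nonneg
  have hhalf : (1 - q) * D ≤ 2 * x := by linarith
  have hharm : a * b / (a + b) ≤ n / 4 := by
    rw [div_le_iff₀ (by positivity)]
    nlinarith [sq_nonneg (a - b)]
  have h1 : (1 - ε) * optCost k A ≤ ε * (n / 4 * D ^ 2) := hsep.trans (by gcongr)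
  calc (1 - q) ^ 2 * (1 - ε) * optCost k A = (1 - q) ^ 2 * ((1 - ε) * optCost k A) := by ring
    _ ≤ (1 - q) ^ 2 * (ε * (n / 4 * D ^ 2)) := by gcongr
    _ = ε * n / 4 * ((1 - q) * D) ^ 2 := by ring
    _ ≤ ε * n / 4 * (2 * x) ^ 2 := by
        have : 0 ≤ (1 - q) * D := mul_nonneg (by linarith) hD0
        gcongr
    _ = ε * n * x ^ 2 := by ring

/-- All but a `(1 + O(√ε)) ε` fraction of the points satisfy the proximity condition. -/
theorem ncard_not_satisfiesProximity_le {c : ℝ} (hc : 0 < c) (hT : IsOptimalClustering A T)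
    {ε : ℝ} (hε : 0 ≤ ε) (h : optCost k A ≤ ε * optCost (k - 1) A) :
    (Set.ncard {i : Fin n | ¬ SatisfiesProximity c A T i} : ℝ) ≤
      (1 + 8 * (4 * c * k + 1) ^ 3 * √ε) * ε * n := by
  classical
  set M := 4 * c * k + 1 with hM
  have hM1 : 1 ≤ M := by
    have : 0 ≤ 4 * c * k := by positivity
    linarith
  set b := √ε with hb
  have hb0 : 0 ≤ b := Real.sqrt_nonneg _
  have hbε : ε = b ^ 2 := (Real.sq_sqrt hε).symm
  have hcoe : Set.ncard {i : Fin n | ¬ SatisfiesProximity c A T i} =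
      (Finset.univ.filter fun i => ¬ SatisfiesProximity c A T i).card := by
    rw [← Set.ncard_coe_finset]
    simp
  set B := Finset.univ.filter fun i => ¬ SatisfiesProximity c A T i with hB
  rw [hcoe]
  have hBn : (B.card : ℝ) ≤ n := by
    have := Finset.card_le_univ B
    rw [Fintype.card_fin] at this
    exact_mod_cast this
  rcases lt_or_ge (1 / 2) (M * b) with hbig | hsmall
  · -- for `√ε > 1 / (2 M)` the bound exceeds `n`
    have h1 : 1 ≤ (2 * (M * b)) ^ 3 := one_le_pow₀ (by linarith)
    have h2 : 1 ≤ (1 + 8 * M ^ 3 * b) * ε := by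
      rw [hbε]
      nlinarith [sq_nonneg b]
    have hn : (0 : ℝ) ≤ n := Nat.cast_nonneg _
    nlinarith
  rcases (optCost_nonneg k A).eq_or_lt with h0 | hpos
  · have : B = ∅ := Finset.filter_eq_empty_iff.mpr fun i _ => not_not.mpr
      (satisfiesProximity_of_optCost_eq_zero c hT h0.symm i)
    rw [this, Finset.card_empty, Nat.cast_zero]
    positivity
  have hb2 : b ≤ 1 / 2 := by nlinarith
  have hεb : ε ≤ b := by nlinarith
  have hq : 2 * c * k * b ≤ 1 := by nlinarith
  set q := 2 * c * k * b with hqdef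
  have hq0 : 0 ≤ q := by positivity
  have hMb : M * b = 2 * q + b := by rw [hM, hqdef]; ring
  have hcount : B.card * ((1 - q) ^ 2 * (1 - ε) * optCost k A) ≤ ε * n * optCost k A := by
    calc (B.card : ℝ) * ((1 - q) ^ 2 * (1 - ε) * optCost k A)
        = ∑ _i ∈ B, (1 - q) ^ 2 * (1 - ε) * optCost k A := by
          rw [Finset.sum_const, nsmul_eq_mul]
      _ ≤ ∑ i ∈ B, ε * n * dist (A i) (clusterMean A T (T i)) ^ 2 :=
          Finset.sum_le_sum fun i hi => optCost_le_of_not_satisfiesProximity hc hT hε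
            (by linarith) h hpos hq (Finset.mem_filter.mp hi).2
      _ ≤ ∑ i, ε * n * dist (A i) (clusterMean A T (T i)) ^ 2 :=
          Finset.sum_le_sum_of_subset_of_nonneg (Finset.subset_univ _)
            fun _ _ _ => by positivity
      _ = ε * n * optCost k A := by rw [← Finset.mul_sum, hT]
  have hcount' : B.card * ((1 - q) ^ 2 * (1 - ε)) ≤ ε * n :=
    le_of_mul_le_mul_right (by linarith) hpos
  have hlow : 1 - M * b ≤ (1 - q) ^ 2 * (1 - ε) := by
    have h1 : (1 - 2 * q) * (1 - ε) ≤ (1 - q) ^ 2 * (1 - ε) :=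
      mul_le_mul_of_nonneg_right (by nlinarith) (by linarith)
    nlinarith [mul_nonneg hq0 hε]
  have h3 : (B.card : ℝ) * (1 - M * b) ≤ ε * n :=
    (mul_le_mul_of_nonneg_left hlow (Nat.cast_nonneg _)).trans hcount'
  have hMb0 : 0 ≤ M * b := by positivity
  -- `1 / (1 - u) ≤ 1 + 2 u` for `u = M √ε ≤ 1 / 2`, and `2 M ≤ 8 M ^ 3`
  have h4 : (B.card : ℝ) ≤ (1 + 2 * (M * b)) * (ε * n) := by
    have h5 : 1 ≤ (1 - M * b) * (1 + 2 * (M * b)) := by nlinarith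
    calc (B.card : ℝ) ≤ B.card * ((1 - M * b) * (1 + 2 * (M * b))) :=
          le_mul_of_one_le_right (Nat.cast_nonneg _) h5
      _ = B.card * (1 - M * b) * (1 + 2 * (M * b)) := by ring
      _ ≤ ε * n * (1 + 2 * (M * b)) := by gcongr
      _ = _ := by ring
  have h6 : 2 * (M * b) ≤ 8 * M ^ 3 * b := by
    have : M ≤ M ^ 3 := le_self_pow₀ hM1 (by norm_num)
    nlinarith
  calc (B.card : ℝ) ≤ (1 + 2 * (M * b)) * (ε * n) := h4
    _ ≤ (1 + 8 * M ^ 3 * b) * (ε * n) := by gcongr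
    _ = _ := by ring

end Proximity

/-! ### Lloyd iterations from a constant-factor approximation -/

section Lloyd

variable {n d k : ℕ} {A : Fin n → EuclideanSpace ℝ (Fin d)}

/-- The new centers of a Lloyd step are at least as good as any centers `w` for the same assignment
of the points; `w` need not be the old centers. -/
theorem kmeansCost_le_of_isLloydStep {ν η : Fin k → EuclideanSpace ℝ (Fin d)}
    {S : Fin n → Fin k}
    (hη : ∀ r, ((cluster S r).Nonempty → η r = clusterMean A S r) ∧ (cluster S r = ∅ → η r = ν r))
    (w : Fin k → EuclideanSpace ℝ (Fin d)) :
    kmeansCost A η ≤ ∑ i, dist (A i) (w (S i)) ^ 2 := by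
  refine (kmeansCost_le_sum A η S).trans ?_
  have : ∀ i, η (S i) = clusterMean A S (S i) := fun i =>
    (hη (S i)).1 ⟨i, Finset.mem_filter.mpr ⟨Finset.mem_univ i, rfl⟩⟩
  simp_rw [this]
  exact sum_clusterMean_le A S w

theorem IsLloydStep.kmeansCost_le {ν η : Fin k → EuclideanSpace ℝ (Fin d)}
    (h : IsLloydStep A ν η) : kmeansCost A η ≤ kmeansCost A ν := by
  obtain ⟨S, hS, hη⟩ := h
  rw [kmeansCost_eq_sum hS]
  exact kmeansCost_le_of_isLloydStep hη ν

theorem optCost_projPoints_le (V : Submodule ℝ (EuclideanSpace ℝ (Fin d)))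
    (A : Fin n → EuclideanSpace ℝ (Fin d)) : optCost k (projPoints V A) ≤ optCost k A := by
  refine le_ciInf fun ν => (optCost_le_kmeansCost _ fun r => V.starProjection (ν r)).trans ?_
  refine Finset.sum_le_sum fun i _ => ?_
  refine ciInf_mono (Set.finite_range _).bddBelow fun r => pow_le_pow_left₀ dist_nonneg ?_ 2
  simpa [projPoints] using V.lipschitzWith_starProjection.dist_le_mul (A i) (ν r)

/-- The means of an optimal clustering span a subspace of dimension at most `k`, so a best subspace
is at least as close to the points. -/
theorem IsBestSubspace.sum_dist_le_optCost [NeZero k]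
    {V : Submodule ℝ (EuclideanSpace ℝ (Fin d))} (hV : IsBestSubspace k A V) :
    ∑ i, dist (A i) (projPoints V A i) ^ 2 ≤ optCost k A := by
  obtain ⟨T, hT⟩ := exists_isOptimalClustering (k := k) A
  set W := Submodule.span ℝ (Set.range (clusterMean A T)) with hW
  have hdim : Module.finrank ℝ W ≤ k := by
    simpa [Set.finrank] using finrank_range_le_card (R := ℝ) (clusterMean A T)
  refine (hV.2 W hdim).trans ?_
  rw [← hT]
  refine Finset.sum_le_sum fun i _ => pow_le_pow_left₀ dist_nonneg ?_ 2
  rw [dist_eq_norm, dist_eq_norm, projPoints, Submodule.starProjection_minimal]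
  exact ciInf_le (f := fun w : W => ‖A i - w‖) ⟨0, by rintro _ ⟨w, rfl⟩; exact norm_nonneg _⟩
    ⟨clusterMean A T (T i), Submodule.subset_span ⟨T i, rfl⟩⟩

theorem dist_sq_le_two_mul {E : Type*} [PseudoMetricSpace E] (x y z : E) :
    dist x z ^ 2 ≤ 2 * dist x y ^ 2 + 2 * dist y z ^ 2 := by
  have h1 := pow_le_pow_left₀ dist_nonneg (dist_triangle x y z) 2
  nlinarith [sq_nonneg (dist x y - dist y z)]

/-- A `β`-approximate solution for the projected points is a `(2 + 2 β)`-approximate solution for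
the points themselves; no separation is needed. -/
theorem IsBaseCenters.kmeansCost_le [NeZero k] {β : ℝ} (hβ : 0 ≤ β)
    {ν : Fin k → EuclideanSpace ℝ (Fin d)} (h : IsBaseCenters β A ν) :
    kmeansCost A ν ≤ (2 + 2 * β) * optCost k A := by
  obtain ⟨V, hV, hν⟩ := h
  obtain ⟨S, hS⟩ := exists_nearest_assignment (projPoints V A) ν
  rw [kmeansCost_eq_sum hS] at hν
  calc kmeansCost A ν ≤ ∑ i, dist (A i) (ν (S i)) ^ 2 := kmeansCost_le_sum A ν S
    _ ≤ ∑ i, (2 * dist (A i) (projPoints V A i) ^ 2 +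
          2 * dist (projPoints V A i) (ν (S i)) ^ 2) :=
        Finset.sum_le_sum fun i _ => dist_sq_le_two_mul _ _ _
    _ ≤ 2 * optCost k A + 2 * (β * optCost k A) := by
        rw [Finset.sum_add_distrib, ← Finset.mul_sum, ← Finset.mul_sum]
        have := mul_le_mul_of_nonneg_left (optCost_projPoints_le (k := k) V A) hβ
        have := hV.sum_dist_le_optCost
        linarith
    _ = _ := by ring

/-- If centers have cost at most `γ Δ_k`, then some point of the optimal cluster `r` witnesses that
one of them is close to the mean `μ_r`. -/
theorem exists_center_near_clusterMean {T : Fin n → Fin k} (hT : IsOptimalClustering A T)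
    {ν : Fin k → EuclideanSpace ℝ (Fin d)} {γ : ℝ} (hν : kmeansCost A ν ≤ γ * optCost k A)
    {r : Fin k} (hr : 0 < ((cluster T r).card : ℝ)) :
    ∃ q, (cluster T r).card * dist (clusterMean A T r) (ν q) ^ 2 ≤
      2 * (1 + γ) * optCost k A := by
  have : NeZero k := ⟨by have := r.2; omega⟩
  obtain ⟨S, hS⟩ := exists_nearest_assignment A ν
  rw [kmeansCost_eq_sum hS] at hν
  by_contra! hcon
  have hne : (cluster T r).Nonempty := Finset.card_pos.mp (by exact_mod_cast hr)
  set N : ℝ := ((cluster T r).card : ℝ) with hN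
  set P := 2 * (1 + γ) * optCost k A
  have h1 : ∑ _i ∈ cluster T r, P / N <
      ∑ i ∈ cluster T r, dist (clusterMean A T r) (ν (S i)) ^ 2 := by
    refine Finset.sum_lt_sum_of_nonempty hne fun i _ => ?_
    rw [div_lt_iff₀' hr]
    exact hcon (S i)
  have h2 : ∑ _i ∈ cluster T r, P / N = P := by
    rw [Finset.sum_const, nsmul_eq_mul, ← hN, mul_div_cancel₀ _ hr.ne']
  have h3 : ∑ i ∈ cluster T r, dist (clusterMean A T r) (ν (S i)) ^ 2 ≤
      ∑ i, (2 * dist (A i) (clusterMean A T (T i)) ^ 2 + 2 * dist (A i) (ν (S i)) ^ 2) := by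
    refine (Finset.sum_le_sum fun i hi => ?_).trans
      (Finset.sum_le_sum_of_subset_of_nonneg (Finset.subset_univ _) fun _ _ _ => by positivity)
    rw [(Finset.mem_filter.mp hi).2, dist_comm (A i) (clusterMean A T r)]
    exact dist_sq_le_two_mul _ _ _
  rw [Finset.sum_add_distrib, ← Finset.mul_sum, ← Finset.mul_sum, hT] at h3
  have : P = 2 * optCost k A + 2 * (γ * optCost k A) := by ring
  linarith

/-- If every mean `μ_r` has a center of `ν` within a small fraction `η` of its distances to the
other means, then moving from the optimal clustering to the Voronoi clustering of `ν` costs little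
for each point: a point that changes its cluster is nearly halfway between the two means. -/
theorem kmeansCost_lloydStep_le_of_near {μ ν ξ : Fin k → EuclideanSpace ℝ (Fin d)}
    {η : ℝ} (hη0 : 0 ≤ η) (hη : η ≤ 1 / 4) {π : Fin k → Fin k}
    (hμ : ∀ r s, r ≠ s → 0 < dist (μ r) (μ s))
    (hπ : ∀ r s, r ≠ s → dist (μ r) (ν (π r)) ≤ η * dist (μ r) (μ s))
    (hstep : IsLloydStep A ν ξ) (T : Fin n → Fin k) :
    kmeansCost A ξ ≤ (1 + 32 * η) * ∑ i, dist (A i) (μ (T i)) ^ 2 := by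
  obtain ⟨S, hS, hξ⟩ := hstep
  have hinj : Function.Injective π := fun r s hrs => by
    by_contra hne
    have h1 := hπ r s hne
    have h2 := hπ s r (Ne.symm hne)
    have h3 := hμ r s hne
    have h4 := dist_triangle_right (μ r) (μ s) (ν (π r))
    rw [dist_comm (μ s) (μ r), ← hrs] at h2
    nlinarith
  set e := Equiv.ofBijective π (Finite.injective_iff_bijective.mp hinj)
  have he : ∀ q, π (e.symm q) = q := e.apply_symm_apply
  refine (kmeansCost_le_of_isLloydStep hξ fun q => μ (e.symm q)).trans ?_
  rw [Finset.mul_sum]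
  refine Finset.sum_le_sum fun i _ => ?_
  set s := e.symm (S i) with hs
  set r := T i with hr
  rcases eq_or_ne r s with hrs | hrs
  · rw [← hrs]
    exact le_mul_of_one_le_left (sq_nonneg _) (by linarith)
  have h1 := hπ r s hrs
  have h2 := hπ s r hrs.symm
  have h3 := hS i (π r)
  rw [he] at h2
  rw [dist_comm (μ s) (μ r)] at h2
  have h4 := dist_triangle (A i) (ν (S i)) (μ s)
  have h5 := dist_triangle (A i) (μ r) (ν (π r))
  have h6 := dist_triangle_left (μ r) (μ s) (A i)
  rw [dist_comm (ν (S i))] at h4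
  set D := dist (μ r) (μ s)
  set x := dist (A i) (μ r)
  have hx : 0 ≤ x := dist_nonneg
  have hD : D ≤ 4 * x := by
    have : 0 ≤ D := dist_nonneg
    nlinarith
  have h7 : dist (A i) (μ s) ≤ (1 + 8 * η) * x := by nlinarith
  calc dist (A i) (μ s) ^ 2 ≤ ((1 + 8 * η) * x) ^ 2 := pow_le_pow_left₀ dist_nonneg h7 2
    _ = (1 + 8 * η) ^ 2 * x ^ 2 := by ring
    _ ≤ (1 + 32 * η) * x ^ 2 := by
        refine mul_le_mul_of_nonneg_right ?_ (sq_nonneg _)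
        nlinarith

/-- One Lloyd step turns a constant-factor approximation into a `1 + O(√ε)`-approximation. -/
theorem kmeansCost_lloydStep_le (hk : 2 ≤ k) {γ ε : ℝ} (hγ : 0 ≤ γ) (hε : 0 ≤ ε)
    (h : optCost k A ≤ ε * optCost (k - 1) A) {ν ξ : Fin k → EuclideanSpace ℝ (Fin d)}
    (hν : kmeansCost A ν ≤ γ * optCost k A) (hstep : IsLloydStep A ν ξ) :
    kmeansCost A ξ ≤ (1 + (64 + 8 * γ) * √(1 + γ) * √ε) * optCost k A := by
  have : NeZero k := ⟨by omega⟩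
  have hΔ := optCost_nonneg k A
  set b := √ε with hb
  set m := √(1 + γ) with hm
  have hb0 : 0 ≤ b := Real.sqrt_nonneg _
  have hm1 : 1 ≤ m := Real.one_le_sqrt.mpr (by linarith)
  have hbε : b ^ 2 = ε := Real.sq_sqrt hε
  have hmγ : m ^ 2 = 1 + γ := Real.sq_sqrt (by linarith)
  have hmb : 0 ≤ m * b := by positivity
  -- unless `√ε` is small compared with `γ`, the claim follows from the bound on the cost of `ν`
  rcases lt_or_ge (1 / 4) (2 * (m * b)) with hbig | hsmall
  · refine (hstep.kmeansCost_le.trans hν).trans (mul_le_mul_of_nonneg_right ?_ hΔ)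
    nlinarith
  rcases hΔ.eq_or_lt with h0 | hpos
  · refine (hstep.kmeansCost_le.trans hν).trans_eq ?_
    rw [← h0, mul_zero, mul_zero]
  obtain ⟨T, hT⟩ := exists_isOptimalClustering (k := k) A
  have hb8 : b ≤ 1 / 8 := by nlinarith
  have hε2 : ε ≤ 1 / 2 := by nlinarith
  have hother : ∀ r : Fin k, ∃ s, r ≠ s := fun r => by
    have : Nontrivial (Fin k) := Fin.nontrivial_iff_two_le.mpr hk
    obtain ⟨s, hs⟩ := exists_ne r
    exact ⟨s, hs.symm⟩
  have hcard : ∀ r, 0 < ((cluster T r).card : ℝ) := fun r => by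
    obtain ⟨s, hs⟩ := hother r
    exact cluster_card_pos_of_separated hT hε (by linarith) h hpos hs
  choose π hπ using fun r => exists_center_near_clusterMean hT hν (hcard r)
  have hsep : ∀ r s, r ≠ s → optCost k A ≤
      2 * ε * ((cluster T r).card * dist (clusterMean A T r) (clusterMean A T s) ^ 2) :=
    fun r s hrs => by
      have h1 := optCost_le_dist_clusterMean hT hε h hrs
      have h2 : ((cluster T r).card * (cluster T s).card /
          ((cluster T r).card + (cluster T s).card) : ℝ) ≤ (cluster T r).card := by
        have := hcard r
        have := hcard s
        rw [div_le_iff₀ (by positivity)]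
        nlinarith
      have h3 := mul_le_mul_of_nonneg_left (mul_le_mul_of_nonneg_right h2
        (sq_nonneg (dist (clusterMean A T r) (clusterMean A T s)))) hε
      nlinarith
  have hdist : ∀ r s, r ≠ s → 0 < dist (clusterMean A T r) (clusterMean A T s) :=
    fun r s hrs => dist_nonneg.lt_of_ne fun h0 => by
      have := hsep r s hrs
      rw [← h0] at this
      simp only [ne_eq, OfNat.ofNat_ne_zero, not_false_eq_true, zero_pow, mul_zero] at this
      linarith
  have hnear : ∀ r s, r ≠ s → dist (clusterMean A T r) (ν (π r)) ≤
      2 * (m * b) * dist (clusterMean A T r) (clusterMean A T s) := fun r s hrs => by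
    refine le_of_sq_le_sq ?_ (by positivity)
    refine le_of_mul_le_mul_left ?_ (hcard r)
    refine (hπ r).trans ?_
    calc 2 * (1 + γ) * optCost k A ≤ 2 * (1 + γ) * _ :=
          mul_le_mul_of_nonneg_left (hsep r s hrs) (by linarith)
      _ = _ := by rw [← hbε, ← hmγ]; ring
  have hfin := kmeansCost_lloydStep_le_of_near (by positivity) hsmall hdist hnear hstep T
  rw [hT] at hfin
  refine hfin.trans (mul_le_mul_of_nonneg_right ?_ hΔ)
  nlinarith [mul_nonneg hγ hmb]

theorem IsClusterRun.kmeansCost_le (hk : 2 ≤ k) {β ε : ℝ} (hβ : 0 ≤ β) (hε : 0 ≤ ε)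
    (h : optCost k A ≤ ε * optCost (k - 1) A) {ν : ℕ → Fin k → EuclideanSpace ℝ (Fin d)}
    (hrun : IsClusterRun β A ν) {t : ℕ} (ht : 1 ≤ t) :
    kmeansCost A (ν t) ≤
      (1 + (64 + 8 * (2 + 2 * β)) * √(1 + (2 + 2 * β)) * √ε) * optCost k A := by
  have : NeZero k := ⟨by omega⟩
  induction t, ht using Nat.le_induction with
  | base =>
    exact kmeansCost_lloydStep_le hk (by linarith) hε h (hrun.1.kmeansCost_le hβ) (hrun.2 0)
  | succ t _ ih => exact (hrun.2 t).kmeansCost_le.trans ih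

end Lloyd

/-! ### Result and step count of the program -/

namespace RealProg

section Semantics

variable {α γ : Type}

@[simp] theorem run_pure (a : α) : (pure a : RealProg α).run = a := rfl

@[simp] theorem steps_pure (a : α) : (pure a : RealProg α).steps = 0 := rfl

@[simp] theorem run_op (o : ArithOp) (x y : ℝ) : (op o x y).run = o.eval x y := rfl

@[simp] theorem steps_op (o : ArithOp) (x y : ℝ) : (op o x y).steps = 1 := rfl

open Classical in
@[simp] theorem run_le (x y : ℝ) : (le x y).run = decide (x ≤ y) := rfl

@[simp] theorem steps_le (x y : ℝ) : (le x y).steps = 1 := rfl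

@[simp] theorem run_bind (p : RealProg α) (f : α → RealProg γ) :
    (p >>= f).run = (f p.run).run := by
  change (seq p f).run = _
  induction p with
  | ret a => rfl
  | arith o x y next ih => exact ih _
  | test x y next ih => exact ih _

@[simp] theorem steps_bind (p : RealProg α) (f : α → RealProg γ) :
    (p >>= f).steps = p.steps + (f p.run).steps := by
  change (seq p f).steps = _
  induction p with
  | ret a => simp [seq, steps, run]
  | arith o x y next ih =>
    simp only [seq, steps, run, ih]
    omega
  | test x y next ih =>
    simp only [seq, steps, run, ih]
    omega

theorem steps_foldlM_le {f : γ → α → RealProg γ} {c : ℕ} (h : ∀ b a, (f b a).steps ≤ c)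
    (l : List α) (b : γ) : (l.foldlM f b).steps ≤ l.length * c := by
  induction l generalizing b with
  | nil => simp
  | cons a l ih =>
    rw [List.foldlM_cons, steps_bind, List.length_cons, Nat.succ_mul, Nat.add_comm]
    exact Nat.add_le_add (ih _) (h b a)

theorem run_foldlM (f : γ → α → RealProg γ) (l : List α) (b : γ) :
    (l.foldlM f b).run = l.foldl (fun b a => (f b a).run) b := by
  induction l generalizing b with
  | nil => rfl
  | cons a l ih => rw [List.foldlM_cons, run_bind, ih, List.foldl_cons]

end Semantics

variable {n d k : ℕ}

theorem steps_sqDist_le (x y : Fin d → ℝ) : (sqDist x y).steps ≤ d * 3 := by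
  unfold sqDist
  exact (steps_foldlM_le (c := 3) (fun b a => by simp) _ _).trans (by simp)

theorem steps_addVec_le (x y : Fin d → ℝ) : (addVec x y).steps ≤ d := by
  unfold addVec
  exact (steps_foldlM_le (c := 1) (fun b a => by simp) _ _).trans (by simp)

theorem steps_divVec_le (x : Fin d → ℝ) (m : ℝ) : (divVec x m).steps ≤ d := by
  unfold divVec
  exact (steps_foldlM_le (c := 1) (fun b a => by simp) _ _).trans (by simp)

theorem steps_nearest_le [NeZero k] (x : Fin d → ℝ) (ν : Fin k → Fin d → ℝ) :
    (nearest x ν).steps ≤ d * 3 + k * (d * 3 + 1) := by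
  unfold nearest
  simp only [steps_bind, steps_pure, add_zero]
  refine Nat.add_le_add (steps_sqDist_le _ _)
    ((steps_foldlM_le (c := d * 3 + 1) (fun b r => ?_) _ _).trans (by simp))
  have := steps_sqDist_le x (ν r)
  simpa

theorem steps_clusterSums_le [NeZero k] (A : Fin n → Fin d → ℝ) (ν : Fin k → Fin d → ℝ) :
    (clusterSums A ν).steps ≤ n * (d * 3 + k * (d * 3 + 1) + 1 + d) := by
  unfold clusterSums
  refine (steps_foldlM_le (c := d * 3 + k * (d * 3 + 1) + 1 + d) (fun b i => ?_) _ _).trans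
    (by simp)
  have h1 := steps_nearest_le (A i) ν
  have h2 := steps_addVec_le (b.2 (nearest (A i) ν).run) (A i)
  simp only [steps_bind, steps_pure, steps_op, add_zero]
  omega

theorem steps_lloydStep_le [NeZero k] (A : Fin n → Fin d → ℝ) (ν : Fin k → Fin d → ℝ) :
    (lloydStep A ν).steps ≤ 7 * ((n + 1) * k * (d + 1)) := by
  unfold lloydStep
  rw [steps_bind]
  refine (Nat.add_le_add (steps_clusterSums_le A ν)
    (steps_foldlM_le (c := d + 1) (fun η r => ?_) _ _)).trans ?_
  · set st := (clusterSums A ν).run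
    have := steps_divVec_le (st.2 r) (st.1 r)
    rw [steps_bind, steps_le]
    split_ifs
    · simp
    · simp only [steps_bind, steps_pure]
      omega
  · rw [List.length_finRange]
    have hk : 1 ≤ k := NeZero.one_le
    have h1 : n * d ≤ n * d * k := Nat.le_mul_of_pos_right _ hk
    have h2 : n ≤ n * k := Nat.le_mul_of_pos_right _ hk
    nlinarith [Nat.zero_le (n * k * d), Nat.zero_le (k * d)]

theorem steps_lloydIter_le [NeZero k] (A : Fin n → Fin d → ℝ) (t : ℕ) (ν : Fin k → Fin d → ℝ) :
    (lloydIter A t ν).steps ≤ 7 * t * ((n + 1) * k * (d + 1)) := by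
  induction t generalizing ν with
  | zero => simp [lloydIter]
  | succ t ih =>
    rw [lloydIter, steps_bind]
    refine (Nat.add_le_add (steps_lloydStep_le A ν) (ih _)).trans_eq ?_
    ring

theorem steps_clusterProg_le [NeZero k]
    (base : (Fin n → EuclideanSpace ℝ (Fin d)) → RealProg (Fin k → EuclideanSpace ℝ (Fin d)))
    (t : ℕ) (A : Fin n → EuclideanSpace ℝ (Fin d)) :
    (clusterProg base t A).steps ≤ (base A).steps + 7 * t * ((n + 1) * k * (d + 1)) := by
  unfold clusterProg
  simp only [steps_bind, steps_pure, add_zero]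
  exact Nat.add_le_add_left (steps_lloydIter_le _ _ _) _

theorem foldl_add_eq_sum {ι : Type} (f : ι → ℝ) (l : List ι) (b : ℝ) :
    l.foldl (fun s j => s + f j) b = b + (l.map f).sum := by
  induction l generalizing b with
  | nil => simp
  | cons a l ih => rw [List.foldl_cons, ih, List.map_cons, List.sum_cons, add_assoc]

theorem foldl_ite_update_apply {ι β : Type} [DecidableEq ι] (P : ι → Prop) [DecidablePred P]
    (g : ι → β) (l : List ι) (b : ι → β) (j : ι) :
    l.foldl (fun v j => if P j then v else Function.update v j (g j)) b j =
      if j ∈ l ∧ ¬ P j then g j else b j := by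
  induction l generalizing b with
  | nil => simp
  | cons a l ih =>
    rw [List.foldl_cons, ih]
    by_cases hl : j ∈ l
    · by_cases hj : P j <;> by_cases ha : P a <;> rcases eq_or_ne j a with rfl | hja <;> simp_all
    · rcases eq_or_ne j a with rfl | hja
      · by_cases hj : P j <;> simp [hl, hj]
      · by_cases ha : P a <;> simp [hl, hja, ha]

theorem foldl_update_apply {ι β : Type} [DecidableEq ι] (g : ι → β) (l : List ι) (b : ι → β)
    (j : ι) : l.foldl (fun v j => Function.update v j (g j)) b j = if j ∈ l then g j else b j := by
  simpa using foldl_ite_update_apply (fun _ => False) g l b j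

theorem run_sqDist (x y : Fin d → ℝ) : (sqDist x y).run = ∑ j, (x j - y j) ^ 2 := by
  unfold sqDist
  rw [run_foldlM]
  simp only [run_bind, run_op, ArithOp.eval]
  rw [foldl_add_eq_sum (fun j => (x j - y j) * (x j - y j)), zero_add]
  simp only [← sq]
  exact (Fin.sum_univ_def _).symm

theorem run_addVec (x y : Fin d → ℝ) : (addVec x y).run = x + y := by
  unfold addVec
  rw [run_foldlM]
  simp only [run_bind, run_op, run_pure, ArithOp.eval]
  funext j
  rw [foldl_update_apply (fun j => x j + y j), if_pos (List.mem_finRange j), Pi.add_apply]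

theorem run_divVec (x : Fin d → ℝ) (m : ℝ) : (divVec x m).run = fun j => x j / m := by
  unfold divVec
  rw [run_foldlM]
  simp only [run_bind, run_op, run_pure, ArithOp.eval]
  funext j
  rw [foldl_update_apply (fun j => x j / m), if_pos (List.mem_finRange j)]

open Classical in
/-- A linear scan that keeps the better of two candidates ends with a candidate that is at least as
good as the initial one and all those scanned, together with its value. -/
theorem foldl_argmin {ι : Type} (f : ι → ℝ) (l : List ι) (a : ι) :
    ∃ q, l.foldl (fun (b : ι × ℝ) r => if b.2 ≤ f r then b else (r, f r)) (a, f a) = (q, f q) ∧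
      f q ≤ f a ∧ ∀ r ∈ l, f q ≤ f r := by
  induction l generalizing a with
  | nil => exact ⟨a, rfl, le_rfl, by simp⟩
  | cons r l ih =>
    rw [List.foldl_cons]
    by_cases h : f a ≤ f r
    · obtain ⟨q, hq, hqa, hql⟩ := ih a
      refine ⟨q, by simpa [h] using hq, hqa, ?_⟩
      simpa [hqa.trans h] using hql
    · obtain ⟨q, hq, hqr, hql⟩ := ih r
      refine ⟨q, by simpa [h] using hq, hqr.trans (le_of_not_ge h), ?_⟩
      simpa [hqr] using hql

theorem run_nearest_le [NeZero k] (x : Fin d → ℝ) (ν : Fin k → Fin d → ℝ) (r : Fin k) :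
    ∑ j, (x j - ν (nearest x ν).run j) ^ 2 ≤ ∑ j, (x j - ν r j) ^ 2 := by
  classical
  obtain ⟨q, hq, -, hmin⟩ := foldl_argmin (fun r => ∑ j, (x j - ν r j) ^ 2)
    (List.finRange k) 0
  have : (nearest x ν).run = q := by
    unfold nearest
    simp only [run_bind, run_pure, run_foldlM, run_sqDist, run_le, decide_eq_true_eq]
    rw [hq]
  rw [this]
  exact hmin r (List.mem_finRange r)

/-- Scanning the points in order accumulates the sizes and the vector sums of the clusters. -/
theorem foldl_clusterSums (A : Fin n → Fin d → ℝ) (S : Fin n → Fin k) (l : List (Fin n))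
    (b : (Fin k → ℝ) × (Fin k → Fin d → ℝ)) :
    l.foldl (fun st i => (Function.update st.1 (S i) (st.1 (S i) + 1),
        Function.update st.2 (S i) (st.2 (S i) + A i))) b =
      (fun r => b.1 r + (l.map fun i => if S i = r then (1 : ℝ) else 0).sum,
        fun r => b.2 r + (l.map fun i => if S i = r then A i else 0).sum) := by
  induction l generalizing b with
  | nil => simp
  | cons i l ih =>
    rw [List.foldl_cons, ih]
    refine Prod.ext (funext fun r => ?_) (funext fun r => ?_)
    all_goals
      rcases eq_or_ne (S i) r with rfl | h
      · simp [add_assoc]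
      · simp [h, h.symm]

theorem run_clusterSums [NeZero k] (A : Fin n → Fin d → ℝ) (ν : Fin k → Fin d → ℝ) :
    (clusterSums A ν).run =
      (fun r => ((cluster (fun i => (nearest (A i) ν).run) r).card : ℝ),
        fun r => ∑ i ∈ cluster (fun i => (nearest (A i) ν).run) r, A i) := by
  unfold clusterSums
  rw [run_foldlM]
  simp only [run_bind, run_op, run_pure, run_addVec, ArithOp.eval]
  rw [foldl_clusterSums A (fun i => (nearest (A i) ν).run)]
  refine Prod.ext (funext fun r => ?_) (funext fun r => ?_)
  · simp [← Fin.sum_univ_def, cluster]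
  · simp [← Fin.sum_univ_def, cluster, Finset.sum_filter]

theorem run_lloydStep [NeZero k] (A : Fin n → Fin d → ℝ) (ν : Fin k → Fin d → ℝ) (r : Fin k) :
    (lloydStep A ν).run r =
      if cluster (fun i => (nearest (A i) ν).run) r = ∅ then ν r
      else fun j => (∑ i ∈ cluster (fun i => (nearest (A i) ν).run) r, A i) j /
        ((cluster (fun i => (nearest (A i) ν).run) r).card : ℝ) := by
  classical
  unfold lloydStep
  rw [run_bind, run_foldlM, run_clusterSums]
  simp only [run_bind, run_le, decide_eq_true_eq, apply_ite run, run_pure, run_divVec]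
  rw [foldl_ite_update_apply]
  simp [ite_not]

/-- The program for one iteration performs a Lloyd step. -/
theorem isLloydStep_run_lloydStep [NeZero k] (A : Fin n → EuclideanSpace ℝ (Fin d))
    (ν : Fin k → Fin d → ℝ) :
    IsLloydStep A (fun r => WithLp.toLp 2 (ν r))
      (fun r => WithLp.toLp 2 ((lloydStep (fun i j => A i j) ν).run r)) := by
  refine ⟨fun i => (nearest (fun j => A i j) ν).run, fun i r => ?_, fun r => ⟨fun h => ?_,
    fun h => ?_⟩⟩
  · rw [EuclideanSpace.dist_eq, EuclideanSpace.dist_eq]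
    simpa [Real.dist_eq] using Real.sqrt_le_sqrt (run_nearest_le (fun j => A i j) ν r)
  · beta_reduce
    rw [run_lloydStep, if_neg h.ne_empty]
    ext j
    simp [clusterMean, div_eq_inv_mul]
  · beta_reduce
    rw [run_lloydStep, if_pos h]

theorem run_lloydIter [NeZero k] (A : Fin n → Fin d → ℝ) (t : ℕ) (ν : Fin k → Fin d → ℝ) :
    (lloydIter A t ν).run = (fun η => (lloydStep A η).run)^[t] ν := by
  induction t generalizing ν with
  | zero => rfl
  | succ t ih => rw [lloydIter, run_bind, ih, Function.iterate_succ_apply]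

theorem exists_isClusterRun_run_clusterProg [NeZero k] {β : ℝ}
    {A : Fin n → EuclideanSpace ℝ (Fin d)}
    {base : (Fin n → EuclideanSpace ℝ (Fin d)) → RealProg (Fin k → EuclideanSpace ℝ (Fin d))}
    (h : IsBaseCenters β A (base A).run) (t : ℕ) :
    ∃ ν : ℕ → Fin k → EuclideanSpace ℝ (Fin d), IsClusterRun β A ν ∧
      (clusterProg base t A).run = ν t := by
  refine ⟨fun s r => WithLp.toLp 2
    (((fun η => (lloydStep (fun i j => A i j) η).run)^[s] fun r j => (base A).run r j) r),
    ⟨h, fun s => ?_⟩, ?_⟩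
  · simp only [Function.iterate_succ_apply']
    exact isLloydStep_run_lloydStep A _
  · unfold clusterProg
    simp only [run_bind, run_pure, run_lloydIter]

end RealProg

theorem mainTheorem10 :
    -- all but a `(1 + O(√ε)) ε` fraction of the points satisfy the proximity condition
    (∀ (k : ℕ) (c : ℝ), 2 ≤ k → 0 < c → ∃ K : ℝ, 0 < K ∧
      ∀ (n d : ℕ) (A : Fin n → EuclideanSpace ℝ (Fin d)) (ε : ℝ), 0 ≤ ε →
        optCost k A ≤ ε * optCost (k - 1) A →
        ∀ T : Fin n → Fin k, IsOptimalClustering A T →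
          (Set.ncard {i : Fin n | ¬ SatisfiesProximity c A T i} : ℝ) ≤ (1 + K * √ε) * ε * n) ∧
    -- every run of the algorithm is within `1 + O(√ε)` of the optimum after its first iteration
    (∀ (k : ℕ) (β : ℝ), 2 ≤ k → 1 ≤ β → ∃ K : ℝ, 0 < K ∧
      ∀ (n d : ℕ) (A : Fin n → EuclideanSpace ℝ (Fin d)) (ε : ℝ), 0 ≤ ε →
        optCost k A ≤ ε * optCost (k - 1) A →
        ∀ ν : ℕ → Fin k → EuclideanSpace ℝ (Fin d), IsClusterRun β A ν →
          ∀ t : ℕ, 1 ≤ t → kmeansCost A (ν t) ≤ (1 + K * √ε) * optCost k A) ∧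
    -- the program performs such a run, in polynomial time on top of its base routine
    (∃ N : ℕ, ∀ (n d k t : ℕ) [NeZero k] (β : ℝ) (A : Fin n → EuclideanSpace ℝ (Fin d))
      (base : (Fin n → EuclideanSpace ℝ (Fin d)) → RealProg (Fin k → EuclideanSpace ℝ (Fin d))),
        (RealProg.clusterProg base t A).steps ≤
            (base A).steps + N * t * ((n + 1) * k * (d + 1)) ∧
        (IsBaseCenters β A (base A).run →
          ∃ ν : ℕ → Fin k → EuclideanSpace ℝ (Fin d), IsClusterRun β A ν ∧
            (RealProg.clusterProg base t A).run = ν t)) := by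
  refine ⟨fun k c _ hc => ⟨8 * (4 * c * k + 1) ^ 3, by positivity, ?_⟩,
    fun k β hk hβ => ⟨(64 + 8 * (2 + 2 * β)) * √(1 + (2 + 2 * β)), by positivity, ?_⟩, 7, ?_⟩
  · intro n d A ε hε h T hT
    exact ncard_not_satisfiesProximity_le hc hT hε h
  · intro n d A ε hε h ν hν t ht
    exact hν.kmeansCost_le hk (by linarith) hε h ht
  · intro n d k t _ β A base
    exact ⟨RealProg.steps_clusterProg_le base t A,
      fun h => RealProg.exists_isClusterRun_run_clusterProg h t⟩
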